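/- **Lemma (Shadow Lemma).** *Setting.* Let $(\mathrm Y,d)$ be a proper geodesic metric space, and let $G$ act properly and isometrically on $\mathrm Y$; fix $o\in \mathrm Y$. A subset $U\subseteq\mathrm Y$ is *$C$-contracting* ($C\ge 1$) if every geodesic $\gamma$ with $d(\gamma,U)\ge C$ has shortest projection to $U$ of diameter at most $C$. A *contracting element* is an infinite order element $h\in G$ such that $\langle h\rangle o$ is contracting and $n\mapsto h^no$ is a quasi-isometric embedding of $\mathbb Z$; its axis is $\mathrm{Ax}(h)=E(h)o$, where $E(h)$ is the set of $g\in G$ for which $g\langle h\rangle o$ and $\langle h\rangle o$ have finite Hausdorff distance. Contracting elements $h,k$ are *independent* if no translate of $\mathrm{Ax}(h)$ is a translate of $\mathrm{Ax}(k)$, all translates of the two axes are $C$-contracting for one $C$, and for each $r\ge 0$ the sets $N_r(U)\cap N_r(V)$, for $U\neq V$ among these translates, have uniformly bounded diameter. Fix pairwise independent contracting elements $h_1,h_2,h_3\in G$. *Boundary.* Let $\overline{\mathrm Y}=\mathrm Y\cup\partial \mathrm Y$ be a metrizable compactification of $\mathrm Y$ ($\mathrm Y$ open and dense) to which the $G$-action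 extends by homeomorphisms, and let $[\cdot]$ be a $G$-invariant partition of $\partial\mathrm Y$. A sequence of subsets $X_n\subseteq \mathrm Y$ is *exiting* if $d(o,X_n)\to\infty$. Assume that $\overline{\mathrm Y}$ is a nontrivial convergence compactification: * (A) for each contracting geodesic ray $\gamma$ there is $\xi\in\partial\mathrm Y$ such that $\gamma$ accumulates into $[\xi]$, and so does every sequence $y_n\in\mathrm Y$ with exiting projections $\pi_\gamma(y_n)$; * (B) for each exiting sequence $X_n$ of $C$-contracting $c$-quasi-geodesics and each $x\in\mathrm Y$, there are a subsequence of the cones $Y_n=\{z:\text{ some geodesic }[x,z]\text{ meets }X_n\}$ and $\xi\in\partial \mathrm Y$ such that any convergent sequence $y_n\in Y_n$ (along the subsequence) tends to a point of $[\xi]$; * (C) the set $\mathcal C\subseteq\partial\mathrm Y$ of *non-pinched* points is non-empty, where $\xi\in\mathcal C$ if, whenever $x_n,y_n\in\mathrm Y$ converge to points of $[\xi]$, all geodesic segments $[x_n,y_n]$ are exiting. *Shadows.* Let $F=\{f_1,f_2,f_3\}$ with $f_i\in\langle h_i\rangle$. For $r>0$ and $y\in Go$, let $\Omega_o(y,r)$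 be the set of $z\in\mathrm Y$ such that some geodesic $[o,z]$ meets the closed ball $B(y,r)$, and $\Omega^F_o(y,r)$ the set of $z\in \mathrm Y$ such that, for some geodesic $[o,z]$, some $k\in G$ with $ko=y$ and some $f\in F$, both $ko$ and $kfo$ are within distance $r$ of $[o,z]$. The shadow $\Pi_o(y,r)$ and the partial shadow $\Pi_o^F(y,r)$ are the intersections with $\partial\mathrm Y$ of the closures in $\overline{\mathrm Y}$ of $\Omega_o(y,r)$ and $\Omega_o^F(y,r)$. *Densities.* Let $\epsilon\ge0$, $\omega>0$, $\lambda\ge 1$. Let $\{B_\xi:\mathrm Y\times\mathrm Y\to\mathbb R\}_{\xi\in\mathcal C}$ satisfy $\limsup_{z\to\xi}|B_\xi(x,y)-(d(x,z)-d(y,z))|\le\epsilon$ for all $\xi\in\mathcal C$, $x,y\in\mathrm Y$ (with $z\in\mathrm Y$). An *$\omega$-dimensional $G$-quasi-equivariant quasi-conformal density* with constant $\lambda$ is a family $\{\mu_x\}_{x\in\mathrm Y}$ of finite Borel measures on $\overline{\mathrm Y}$ with $\mu_o(\overline{\mathrm Y})=1$ such that for all $g,h\in G$, $x\in\mathrm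 Y$ $$\frac1\lambda\le\frac{d g_\star\mu_x}{d\mu_{gx}}(\xi)\le\lambda\ \text{ on } \partial\mathrm Y,\qquad \frac1\lambda e^{-\omega B_\xi(gx,hx)}\le\frac{d\mu_{gx}}{d\mu_{hx}}(\xi)\le\lambda e^{-\omega B_\xi(gx,hx)}\ \text{ on }\mathcal C,$$ almost everywhere, with absolute continuity on the indicated sets. The set $\mathcal C$ is assumed to be $\mu_x$-measurable for all $x$. *Conclusion.* There are $L>0$ and $r_0>0$ such that, for every $F$ as above with $\min_i d(o,f_io)\ge L$ and every density as above with $\mu_o(\mathcal C)>0$, $$c\,e^{-\omega d(o,go)}\ \le\ \mu_o(\Pi^F_o(go,r)\cap\mathcal C)\ \le\ \mu_o(\Pi_o(go,r)\cap\mathcal C)\ \le\ D\,e^{-\omega d(o,go)}$$ for all $g\in G$ and $r\ge r_0$. Here, once the setting and the boundary (including $o$ and $h_1,h_2,h_3$) are fixed, $D$ depends only on $\omega,\lambda,\epsilon,r$; and $c>0$ depends only on $\omega,\lambda,\epsilon,F$ and a positive lower bound for $\mu_o(\mathcal C)$, and not on $r$, $g$, the family $B$ or the density. -/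

import Mathlib

open Set Filter Topology MeasureTheory

noncomputable section

namespace ShadowLemma

/-! ### Metric notions: geodesics, projections, contracting sets -/

section Metric

variable {Y : Type*} [MetricSpace Y]

/-- `S` is (the image of) a geodesic segment from `x` to `y`. -/
def IsGeodesicSegment (S : Set Y) (x y : Y) : Prop :=
  ∃ (l : ℝ) (p : ℝ → Y), 0 ≤ l ∧ p 0 = x ∧ p l = y ∧ S = p '' Icc 0 l ∧
    ∀ s ∈ Icc (0 : ℝ) l, ∀ t ∈ Icc (0 : ℝ) l, dist (p s) (p t) = |s - t|

/-- Any two points are joined by a geodesic segment. -/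
def IsGeodesicSpace (Y : Type*) [MetricSpace Y] : Prop :=
  ∀ x y : Y, ∃ S : Set Y, IsGeodesicSegment S x y

/-- `p : [0, ∞) → Y` is a geodesic ray (values of `p` at negative reals are irrelevant). -/
def IsGeodesicRay (p : ℝ → Y) : Prop :=
  ∀ s ∈ Ici (0 : ℝ), ∀ t ∈ Ici (0 : ℝ), dist (p s) (p t) = |s - t|

/-- Shortest projection `π_U(A)` of a set `A` to a set `U`. -/
def proj (U A : Set Y) : Set Y :=
  {u | u ∈ U ∧ ∃ a ∈ A, dist a u = Metric.infDist a U}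

/-- The diameter of `A` is at most `D`. -/
def DiamLE (A : Set Y) (D : ℝ) : Prop :=
  ∀ x ∈ A, ∀ y ∈ A, dist x y ≤ D

/-- `U` is `C`-contracting: every geodesic at distance at least `C` from `U` has a projection to
`U` of diameter at most `C`. (Infinite geodesics are covered through their subsegments.) -/
def IsContracting (C : ℝ) (U : Set Y) : Prop :=
  1 ≤ C ∧ ∀ (S : Set Y) (x y : Y), IsGeodesicSegment S x y →
    (∀ z ∈ S, C ≤ Metric.infDist z U) → DiamLE (proj U S) C

/-- A family of sets is a contracting system: all members are `C`-contracting with one `C`. -/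
def IsContractingSystem (𝓕 : Set (Set Y)) : Prop :=
  ∃ C : ℝ, ∀ U ∈ 𝓕, IsContracting C U

/-- Bounded intersection: for distinct members `U`, `V`, the set `N_r(U) ∩ N_r(V)` has diameter
at most `τ r`. -/
def HasBoundedIntersection (𝓕 : Set (Set Y)) : Prop :=
  ∃ τ : ℝ → ℝ, ∀ r : ℝ, 0 ≤ r → ∀ U ∈ 𝓕, ∀ V ∈ 𝓕, U ≠ V →
    DiamLE (Metric.cthickening r U ∩ Metric.cthickening r V) (τ r)

/-- `S` is the image of a `c`-quasi-geodesic: a path with arc-length parametrization on a closed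
interval (possibly infinite), each of whose subpaths has length at most `c` times the distance of
its endpoints plus `c`. -/
def IsQuasiGeodesic (c : ℝ) (S : Set Y) : Prop :=
  ∃ (I : Set ℝ) (p : ℝ → Y), I.Nonempty ∧ I.OrdConnected ∧ IsClosed I ∧
    ContinuousOn p I ∧ HasUnitSpeedOn p I ∧ S = p '' I ∧
    ∀ s ∈ I, ∀ t ∈ I, s ≤ t → t - s ≤ c * dist (p s) (p t) + c

/-- A sequence of subsets is exiting if its distance to a base point tends to infinity. -/
def Exiting (A : ℕ → Set Y) : Prop :=
  ∀ o : Y, Tendsto (fun n => Metric.infDist o (A n)) atTop atTop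

/-- The cone `Ω_o(A)`: points `z` such that some geodesic `[o, z]` meets `A`. -/
def cone (o : Y) (A : Set Y) : Set Y :=
  {z | ∃ S : Set Y, IsGeodesicSegment S o z ∧ (S ∩ A).Nonempty}

end Metric

/-! ### Contracting elements, axes, independence, partial cones -/

section Group

variable {G Y : Type*} [Group G] [MetricSpace Y] [MulAction G Y]

/-- The orbit `⟨h⟩ o`. -/
def cyclicOrbit (o : Y) (h : G) : Set Y :=
  {y | ∃ n : ℤ, y = h ^ n • o}

/-- Translate `g A` of a subset of `Y`. -/
def translate (g : G) (A : Set Y) : Set Y := (fun y => g • y) '' A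

/-- A contracting element with quasi-isometrically embedded image: `h` has infinite order, `⟨h⟩ o`
is a contracting subset and `n ↦ hⁿ o` is a quasi-isometric embedding of `ℤ`. -/
def IsContractingElement (o : Y) (h : G) : Prop :=
  ¬ IsOfFinOrder h ∧ (∃ C : ℝ, IsContracting C (cyclicOrbit o h)) ∧
    ∃ a b : ℝ, 1 ≤ a ∧ 0 ≤ b ∧ ∀ m n : ℤ,
      |(m : ℝ) - n| / a - b ≤ dist (h ^ m • o) (h ^ n • o) ∧
      dist (h ^ m • o) (h ^ n • o) ≤ a * |(m : ℝ) - n| + b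

/-- `E(h)`: the elements `g` for which `g⟨h⟩o` and `⟨h⟩o` have finite Hausdorff distance. -/
def stabE (o : Y) (h : G) : Set G :=
  {g | ∃ r : ℝ, 0 < r ∧
    translate g (cyclicOrbit o h) ⊆ Metric.cthickening r (cyclicOrbit o h) ∧
    cyclicOrbit o h ⊆ Metric.cthickening r (translate g (cyclicOrbit o h))}

/-- The axis `Ax(h) = E(h) o`. -/
def axis (o : Y) (h : G) : Set Y := (fun g : G => g • o) '' stabE o h

/-- `h₁`, `h₂` are independent: the translates of their axes form a contracting system with bounded
intersection. The translates of `Ax(h₁)` and of `Ax(h₂)` are different members of the system, so no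
translate of `Ax(h₁)` is `Ax(h₂)`. -/
def Independent (o : Y) (h₁ h₂ : G) : Prop :=
  IsContractingSystem ({U | ∃ g : G, U = translate g (axis o h₁) ∨ U = translate g (axis o h₂)}) ∧
  HasBoundedIntersection
    ({U | ∃ g : G, U = translate g (axis o h₁) ∨ U = translate g (axis o h₂)}) ∧
  ∀ g : G, translate g (axis o h₁) ≠ axis o h₂

/-- The geodesic (with image) `S` has an `(r, F)`-barrier at the point `y ∈ G o`: there are `k ∈ G`
with `k o = y` and `f ∈ F` such that `k o` and `k f o` are within distance `r` of `S`. -/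
def HasBarrierAt (o : Y) (F : Set G) (r : ℝ) (S : Set Y) (y : Y) : Prop :=
  ∃ k : G, k • o = y ∧ ∃ f ∈ F,
    max (Metric.infDist (k • o) S) (Metric.infDist (k • f • o) S) ≤ r

/-- The `(r, F)`-cone `Ω_x^F(y, r)`. -/
def partialCone (o : Y) (F : Set G) (x y : Y) (r : ℝ) : Set Y :=
  {z | ∃ S : Set Y, IsGeodesicSegment S x z ∧ HasBarrierAt o F r S y}

end Group

/-! ### Compactifications, boundary, shadows -/

section Boundary

variable {Y X : Type*} [MetricSpace Y] [TopologicalSpace X]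

/-- The boundary `∂Y` in a compactification `ι : Y → X`. -/
def boundary (ι : Y → X) : Set X := (range ι)ᶜ

/-- The class `[ξ] ⊆ ∂Y` of a boundary point for a partition of `∂Y`. -/
def locus (ι : Y → X) (s : Setoid (boundary ι)) (ξ : boundary ι) : Set X :=
  {η | ∃ hη : η ∈ boundary ι, s ξ ⟨η, hη⟩}

/-- The limit set in `∂Y` of a subset of `Y`. -/
def limitSet (ι : Y → X) (A : Set Y) : Set X := closure (ι '' A) ∩ boundary ι

/-- The usual shadow `Π_x(y, r)`. -/
def shadow (ι : Y → X) (x y : Y) (r : ℝ) : Set X :=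
  limitSet ι (cone x (Metric.closedBall y r))

/-- The partial shadow `Π_x^F(y, r)`. -/
def partialShadow {G : Type*} [Group G] [MulAction G Y] (ι : Y → X) (o : Y) (F : Set G)
    (x y : Y) (r : ℝ) : Set X :=
  limitSet ι (partialCone o F x y r)

/-- Every contracting geodesic ray `p` accumulates into some class `[ξ]`, and every
sequence whose projections to `p` are exiting accumulates into `[ξ]`. -/
def AssumptionA (ι : Y → X) (s : Setoid (boundary ι)) : Prop :=
  ∀ p : ℝ → Y, IsGeodesicRay p → (∃ C : ℝ, IsContracting C (p '' Ici 0)) →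
    ∃ ξ : boundary ι,
      (∀ η : X, MapClusterPt η atTop (fun t : ℝ => ι (p t)) → η ∈ locus ι s ξ) ∧
      ∀ y : ℕ → Y, Exiting (fun n => proj (p '' Ici 0) {y n}) →
        ∀ η : X, MapClusterPt η atTop (fun n => ι (y n)) → η ∈ locus ι s ξ

/-- For every exiting sequence of `C`-contracting quasi-geodesics, a subsequence of their
cones accumulates into a class `[ξ]`. -/
def AssumptionB (ι : Y → X) (s : Setoid (boundary ι)) : Prop :=
  ∀ (C c : ℝ) (A : ℕ → Set Y),
    (∀ n, IsContracting C (A n) ∧ IsQuasiGeodesic c (A n)) → Exiting A →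
    ∀ o : Y, ∃ φ : ℕ → ℕ, StrictMono φ ∧ ∃ ξ : boundary ι,
      ∀ y : ℕ → Y, (∀ n, y n ∈ cone o (A (φ n))) →
        ∀ η : X, Tendsto (fun n => ι (y n)) atTop (𝓝 η) → η ∈ locus ι s ξ

/-- The set `𝒞 ⊆ ∂Y` of non-pinched points: if `x_n`, `y_n` in `Y` converge to points of `[ξ]`,
then the geodesic segments `[x_n, y_n]` are exiting. -/
def nonPinched (ι : Y → X) (s : Setoid (boundary ι)) : Set X :=
  {ξ | ∃ hξ : ξ ∈ boundary ι, ∀ x y : ℕ → Y, ∀ η ∈ locus ι s ⟨ξ, hξ⟩, ∀ ζ ∈ locus ι s ⟨ξ, hξ⟩,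
    Tendsto (fun n => ι (x n)) atTop (𝓝 η) → Tendsto (fun n => ι (y n)) atTop (𝓝 ζ) →
    ∀ S : ℕ → Set Y, (∀ n, IsGeodesicSegment (S n) (x n) (y n)) → Exiting S}

/-- `ι : Y → X` is a (nontrivial) convergence compactification for the action of `G`, with respect
to the partition `s` of the boundary. Compactness and metrizability of `X` are imposed as
type class assumptions where this is used. -/
structure IsConvergenceCompactification (G : Type*) [Group G] [MulAction G Y] [MulAction G X]
    (ι : Y → X) (s : Setoid (boundary ι)) : Prop where
  isOpenEmbedding : IsOpenEmbedding ι
  denseRange : DenseRange ι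
  smul_map : ∀ (g : G) (y : Y), ι (g • y) = g • ι y
  partition_invariant : ∀ (g : G) (ξ η ξ' η' : boundary ι), s ξ η →
    (ξ' : X) = g • (ξ : X) → (η' : X) = g • (η : X) → s ξ' η'
  assumptionA : AssumptionA ι s
  assumptionB : AssumptionB ι s
  nonPinched_nonempty : (nonPinched ι s).Nonempty

/-- `B` is a family of Busemann quasi-cocycles based at the points of `𝒞`, with error `ε`:
`limsup_{z → ξ} |B_ξ(x, y) - B_z(x, y)| ≤ ε`, where `B_z(x, y) = d(x, z) - d(y, z)`
(the limsup is of a bounded function, along the points `z ∈ Y` tending to `ξ`). -/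
def IsBusemannFamily (ι : Y → X) (𝒞 : Set X) (B : X → Y → Y → ℝ) (ε : ℝ) : Prop :=
  ∀ ξ ∈ 𝒞, ∀ x y : Y,
    limsup (fun z : Y => |B ξ x y - (dist x z - dist y z)|) (comap ι (𝓝 ξ)) ≤ ε

end Boundary

/-! ### Quasi-conformal densities -/

section Density

variable {G Y X : Type*} [Group G] [MetricSpace Y] [MulAction G Y] [TopologicalSpace X]
  [MulAction G X] [MeasurableSpace X]

/-- On the set `A`, the measure `ν` is absolutely continuous with respect to `μ`, and
`a ≤ dν/dμ ≤ b` almost everywhere. -/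
def DerivBetween (ν μ : Measure X) (A : Set X) (a b : X → ℝ) : Prop :=
  ν.restrict A ≪ μ.restrict A ∧
  ∀ᵐ ξ ∂(μ.restrict A),
    ENNReal.ofReal (a ξ) ≤ (ν.restrict A).rnDeriv (μ.restrict A) ξ ∧
    (ν.restrict A).rnDeriv (μ.restrict A) ξ ≤ ENNReal.ofReal (b ξ)

/-- `x ↦ μ_x` is an `ω`-dimensional `G`-quasi-equivariant quasi-conformal density with constant
`lam`, normalized at `o`. -/
structure IsQuasiConformalDensity (G : Type*) [Group G] [MulAction G Y] [MulAction G X]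
    (ι : Y → X) (𝒞 : Set X) (B : X → Y → Y → ℝ) (o : Y) (ω lam : ℝ) (μ : Y → Measure X) :
    Prop where
  finite : ∀ x, IsFiniteMeasure (μ x)
  normalized : μ o univ = 1
  quasi_equivariant : ∀ (g : G) (x : Y),
    DerivBetween ((μ x).map (fun ξ => g • ξ)) (μ (g • x)) (boundary ι)
      (fun _ => 1 / lam) (fun _ => lam)
  quasi_conformal : ∀ (g h : G) (x : Y),
    DerivBetween (μ (g • x)) (μ (h • x)) 𝒞
      (fun ξ => 1 / lam * Real.exp (-ω * B ξ (g • x) (h • x)))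
      (fun ξ => lam * Real.exp (-ω * B ξ (g • x) (h • x)))

end Density

end ShadowLemma

end

namespace ShadowLemma

/-! ### Geodesics and contracting sets -/

section Metric

variable {Y : Type*} [MetricSpace Y]

/-! Upper bound: if a geodesic `[o, z]` meets the ball `B(go, r)`, then `d(o, z) - d(go, z) ≥ d(o,
go) - 2r`. Letting `z` tend to `ξ`, the Busemann cocycle satisfies `B_ξ(o, go) ≥ d(o, go) - 2r - ε`
on the shadow. Conformality compares `μ_o` with `μ_{go}` there, and quasi-equivariance bounds the
boundary mass of `μ_{go}` by `λ` (`measure_shadow_le`).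

Lower bound: the geometric input is `exists_extension`. Any point projects near `o` on all but at
most one of the three axes, so for given `x` and `z` some axis is good for both. A long `f_i` along
that axis separates the projections of `x` and `f_i z`, and the contracting property forces every
geodesic `[x, f_i z]` to pass near `o` and `f_i o`. With `x = g⁻¹o`, translating by `g` shows that
`Y` is covered by three pullbacks of the partial cone at `go`, by the elements `g f_i`. Closures of
finite unions and density of `Y` turn this into a covering of the non-pinched set by three pullbacks
of the partial shadow (`nonPinched_subset_iUnion`). Each pullback has measure at most `λ² exp(ω(d(o,
g f_i o) + ε))` times that of the partial shadow, and summing gives the bound. -/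

theorem IsGeodesicSegment.symm {S : Set Y} {x y : Y} (h : IsGeodesicSegment S x y) :
    IsGeodesicSegment S y x := by
  obtain ⟨l, p, hl, h0, h1, rfl, hp⟩ := h
  refine ⟨l, fun t => p (l - t), hl, by simpa using h1, by simpa using h0, ?_, ?_⟩
  · ext z
    constructor
    · rintro ⟨t, ht, rfl⟩
      exact ⟨l - t, ⟨by linarith [ht.2], by linarith [ht.1]⟩, by simp⟩
    · rintro ⟨t, ht, rfl⟩
      exact ⟨l - t, ⟨by linarith [ht.2], by linarith [ht.1]⟩, rfl⟩
  · intro s hs t ht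
    rw [hp (l - s) ⟨by linarith [hs.2], by linarith [hs.1]⟩ (l - t)
      ⟨by linarith [ht.2], by linarith [ht.1]⟩, abs_sub_comm s t]
    congr 1
    ring

theorem IsGeodesicSegment.image {S : Set Y} {x y : Y} (h : IsGeodesicSegment S x y)
    {φ : Y → Y} (hφ : Isometry φ) : IsGeodesicSegment (φ '' S) (φ x) (φ y) := by
  obtain ⟨l, p, hl, rfl, rfl, rfl, hp⟩ := h
  exact ⟨l, φ ∘ p, hl, rfl, rfl, by rw [image_comp], fun s hs t ht => by
    simpa [hφ.dist_eq] using hp s hs t ht⟩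

theorem isGeodesicSegment_subsegment {p : ℝ → Y} {l a b : ℝ}
    (hp : ∀ s ∈ Icc (0 : ℝ) l, ∀ t ∈ Icc (0 : ℝ) l, dist (p s) (p t) = |s - t|)
    (ha : 0 ≤ a) (hab : a ≤ b) (hb : b ≤ l) :
    IsGeodesicSegment (p '' Icc a b) (p a) (p b) := by
  refine ⟨b - a, fun t => p (a + t), by linarith, by simp, by simp, ?_, ?_⟩
  · ext z
    constructor
    · rintro ⟨t, ht, rfl⟩
      exact ⟨t - a, ⟨by linarith [ht.1], by linarith [ht.2]⟩, by simp⟩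
    · rintro ⟨t, ht, rfl⟩
      exact ⟨a + t, ⟨by linarith [ht.1], by linarith [ht.2]⟩, rfl⟩
  · intro s hs t ht
    rw [hp (a + s) ⟨by linarith [hs.1], by linarith [hs.2]⟩ (a + t)
      ⟨by linarith [ht.1], by linarith [ht.2]⟩]
    congr 1
    ring

theorem continuousOn_of_dist_eq {p : ℝ → Y} {l : ℝ}
    (hp : ∀ s ∈ Icc (0 : ℝ) l, ∀ t ∈ Icc (0 : ℝ) l, dist (p s) (p t) = |s - t|) :
    ContinuousOn p (Icc 0 l) := by
  have : LipschitzOnWith 1 p (Icc 0 l) :=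
    LipschitzOnWith.of_dist_le_mul fun s hs t ht => by
      simp [hp s hs t ht, Real.dist_eq]
  exact this.continuousOn

/-- A continuous function that starts above a level and reaches it has a first hitting time. -/
theorem exists_first_hit {f : ℝ → ℝ} {a b c : ℝ} (hf : ContinuousOn f (Icc a b)) (ha : c ≤ f a)
    {t : ℝ} (ht : t ∈ Icc a b) (htc : f t ≤ c) :
    ∃ u ∈ Icc a b, f u = c ∧ ∀ s ∈ Icc a u, c ≤ f s := by
  have hT : IsCompact (Icc a b ∩ f ⁻¹' {c}) :=
    isCompact_Icc.of_isClosed_subset (hf.preimage_isClosed_of_isClosed isClosed_Icc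
      isClosed_singleton) inter_subset_left
  have key : ∀ v ∈ Icc a b, f v ≤ c → ∃ w ∈ Icc a v, f w = c := fun v hv hvc =>
    intermediate_value_Icc' hv.1 (hf.mono (Icc_subset_Icc_right hv.2)) ⟨hvc, ha⟩
  obtain ⟨w, hw, hwc⟩ := key t ht htc
  obtain ⟨u, hu, hmin⟩ := hT.exists_isLeast ⟨w, ⟨hw.1, hw.2.trans ht.2⟩, hwc⟩
  refine ⟨u, hu.1, hu.2, fun s hs => ?_⟩
  by_contra! hsc
  obtain ⟨w', hw', hwc'⟩ := key s ⟨hs.1, hs.2.trans hu.1.2⟩ hsc.le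
  have h1 : u ≤ w' := hmin ⟨⟨hw'.1, hw'.2.trans (hs.2.trans hu.1.2)⟩, hwc'⟩
  have h2 : s = u := le_antisymm hs.2 (h1.trans hw'.2)
  rw [h2] at hsc
  exact hsc.ne hu.2

/-- A continuous function that ends above a level and reaches it has a last hitting time. -/
theorem exists_last_hit {f : ℝ → ℝ} {a b c : ℝ} (hf : ContinuousOn f (Icc a b)) (hb : c ≤ f b)
    {t : ℝ} (ht : t ∈ Icc a b) (htc : f t ≤ c) :
    ∃ u ∈ Icc a b, f u = c ∧ ∀ s ∈ Icc u b, c ≤ f s := by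
  obtain ⟨u, hu, huc, hus⟩ := exists_first_hit (f := fun s => f (-s)) (a := -b) (b := -a) (c := c)
    (hf.comp continuous_neg.continuousOn
      fun s hs => ⟨by linarith [hs.2], by linarith [hs.1]⟩) (by simpa using hb) (t := -t)
    ⟨by linarith [ht.2], by linarith [ht.1]⟩ (by simpa using htc)
  refine ⟨-u, ⟨by linarith [hu.2], by linarith [hu.1]⟩, huc, fun s hs => ?_⟩
  simpa using hus (-s) ⟨by linarith [hs.2], by linarith [hs.1]⟩

theorem IsContracting.mono {C C' : ℝ} {U : Set Y} (h : IsContracting C U) (hC : C ≤ C') :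
    IsContracting C' U :=
  ⟨h.1.trans hC, fun S x y hS hd u hu v hv =>
    (h.2 S x y hS (fun z hz => hC.trans (hd z hz)) u hu v hv).trans hC⟩

theorem proj_nonempty [ProperSpace Y] {U : Set Y} (hU : IsClosed U) (hne : U.Nonempty) (x : Y) :
    (proj U {x}).Nonempty := by
  obtain ⟨u, hu, h⟩ := hU.exists_infDist_eq_dist hne x
  exact ⟨u, hu, x, rfl, h.symm⟩

theorem dist_of_mem_proj {U : Set Y} {x u : Y} (h : u ∈ proj U {x}) :
    dist x u = Metric.infDist x U := by
  obtain ⟨_, _, rfl, h⟩ := h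
  exact h

theorem proj_mono {U A A' : Set Y} (h : A ⊆ A') : proj U A ⊆ proj U A' :=
  fun _ ⟨hu, a, ha, h'⟩ => ⟨hu, a, h ha, h'⟩

/-- If the endpoints of a geodesic have distant projections to a contracting set, the geodesic
passes near the projection of its initial point. -/
theorem IsContracting.exists_dist_le [ProperSpace Y] {C : ℝ} {U S : Set Y} {x y u v : Y}
    (hC : IsContracting C U) (hU : IsClosed U) (hS : IsGeodesicSegment S x y)
    (hu : u ∈ proj U {x}) (hv : v ∈ proj U {y}) (huv : C < dist u v) :
    ∃ z ∈ S, dist u z ≤ 2 * C := by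
  have hC1 := hC.1
  have hSS := hS
  obtain ⟨l, p, hl, rfl, rfl, rfl, hp⟩ := hS
  by_cases h0 : Metric.infDist (p 0) U ≤ C
  · refine ⟨p 0, ⟨0, ⟨le_rfl, hl⟩, rfl⟩, ?_⟩
    rw [dist_comm, dist_of_mem_proj hu]
    linarith
  have hfar : ∃ t ∈ Icc 0 l, Metric.infDist (p t) U ≤ C := by
    by_contra! hfar
    refine absurd (hC.2 _ _ _ hSS ?_ u (proj_mono ?_ hu) v (proj_mono ?_ hv)) huv.not_ge
    · rintro _ ⟨t, ht, rfl⟩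
      exact (hfar t ht).le
    · rintro _ rfl
      exact ⟨0, ⟨le_rfl, hl⟩, rfl⟩
    · rintro _ rfl
      exact ⟨l, ⟨hl, le_rfl⟩, rfl⟩
  obtain ⟨t, ht, htC⟩ := hfar
  -- Until the first time at distance `C` from `U` the projection moves by at most `C`; at that time
  -- the geodesic is `C` away from its projection. This gives `2 * C`.
  obtain ⟨w, hw, hwC, hws⟩ := exists_first_hit
    ((Metric.continuous_infDist_pt U).comp_continuousOn (continuousOn_of_dist_eq hp))
    (not_le.1 h0).le ht htC
  simp only [Function.comp_apply] at hwC hws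
  obtain ⟨q, hq⟩ := proj_nonempty hU ⟨u, hu.1⟩ (p w)
  have h1 : dist u q ≤ C := by
    refine hC.2 _ _ _ (isGeodesicSegment_subsegment hp le_rfl hw.1 hw.2) ?_ u
      (proj_mono ?_ hu) q (proj_mono ?_ hq)
    · rintro _ ⟨s, hs, rfl⟩
      exact hws s hs
    · rintro _ rfl
      exact ⟨0, ⟨le_rfl, hw.1⟩, rfl⟩
    · rintro _ rfl
      exact ⟨w, ⟨hw.1, le_rfl⟩, rfl⟩
  refine ⟨p w, ⟨w, hw, rfl⟩, ?_⟩
  have h2 := dist_of_mem_proj hq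
  have h3 := dist_triangle_right u (p w) q
  linarith

/-- Contracting sets are quasi-convex. -/
theorem IsContracting.infDist_le [ProperSpace Y] {C D : ℝ} {U S : Set Y} {x y z : Y}
    (hC : IsContracting C U) (hU : IsClosed U) (hne : U.Nonempty) (hS : IsGeodesicSegment S x y)
    (hCD : C ≤ D) (hx : Metric.infDist x U ≤ D) (hy : Metric.infDist y U ≤ D) (hz : z ∈ S) :
    Metric.infDist z U ≤ 4 * D := by
  have hC1 := hC.1
  obtain ⟨l, p, hl, rfl, rfl, rfl, hp⟩ := hS
  obtain ⟨s, hs, rfl⟩ := hz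
  by_cases hsD : Metric.infDist (p s) U ≤ D
  · linarith
  have hcont := (Metric.continuous_infDist_pt U).comp_continuousOn (continuousOn_of_dist_eq hp)
  -- The excursion `[a, b]` around `s` outside the `D`-neighbourhood has length at most `D + C + D ≤
  -- 3 * D`, because its projection has diameter at most `C`.
  obtain ⟨b, hb, hbD, hbs⟩ := exists_first_hit (hcont.mono (Icc_subset_Icc_left hs.1))
    (not_le.1 hsD).le (t := l) ⟨hs.2, le_rfl⟩ hy
  obtain ⟨a, ha, haD, has⟩ := exists_last_hit (hcont.mono (Icc_subset_Icc_right hs.2))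
    (not_le.1 hsD).le (t := 0) ⟨le_rfl, hs.1⟩ hx
  simp only [Function.comp_apply] at haD has hbD hbs
  obtain ⟨u, hu⟩ := proj_nonempty hU hne (p a)
  obtain ⟨v, hv⟩ := proj_nonempty hU hne (p b)
  have hab : a ≤ b := ha.2.trans hb.1
  have h1 : dist u v ≤ C := by
    refine hC.2 _ _ _ (isGeodesicSegment_subsegment hp ha.1 hab hb.2) ?_ u
      (proj_mono ?_ hu) v (proj_mono ?_ hv)
    · rintro _ ⟨t, ht, rfl⟩
      rcases le_total t s with h | h
      · exact hCD.trans (has t ⟨ht.1, h⟩)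
      · exact hCD.trans (hbs t ⟨h, ht.2⟩)
    · rintro _ rfl
      exact ⟨a, ⟨le_rfl, hab⟩, rfl⟩
    · rintro _ rfl
      exact ⟨b, ⟨hab, le_rfl⟩, rfl⟩
  have h2 := dist_of_mem_proj hu
  have h3 := dist_of_mem_proj hv
  have h4 := dist_triangle4 (p a) u v (p b)
  rw [dist_comm v, hp a ⟨ha.1, ha.2.trans hs.2⟩ b ⟨hs.1.trans hb.1, hb.2⟩, abs_sub_comm,
    abs_of_nonneg (by linarith)] at h4
  have h5 : Metric.infDist (p s) U ≤ Metric.infDist (p a) U + dist (p s) (p a) :=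
    Metric.infDist_le_infDist_add_dist
  rw [hp s hs a ⟨ha.1, ha.2.trans hs.2⟩, abs_of_nonneg (by linarith [ha.2])] at h5
  linarith [hb.1]

theorem mem_cthickening_of_infDist_le [ProperSpace Y] {U : Set Y} {x : Y} {r : ℝ}
    (hU : IsClosed U) (hne : U.Nonempty) (h : Metric.infDist x U ≤ r) :
    x ∈ Metric.cthickening r U := by
  obtain ⟨u, hu⟩ := proj_nonempty hU hne x
  exact Metric.mem_cthickening_of_dist_le x u r U hu.1 ((dist_of_mem_proj hu).trans_le h)

/-- The geodesic from `o` passes `U` first and `V` later. Quasi-convexity, applied up to time `t`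
with endpoints within `2 * C` of `V`, puts `p s` within `8 * C` of `V`; it is also close to `U`, so
bounded intersection keeps it within `T` of `o`. -/
theorem dist_le_of_bounded_intersection [ProperSpace Y] {C T : ℝ} {U V : Set Y} {o u v : Y}
    (hCV : IsContracting C V) (hVc : IsClosed V) (hoU : o ∈ U) (hoV : o ∈ V)
    (hT : DiamLE (Metric.cthickening (8 * C) U ∩ Metric.cthickening (8 * C) V) T)
    (hu : u ∈ U) (hv : v ∈ V) {p : ℝ → Y} {l : ℝ} (hp0 : p 0 = o)
    (hp : ∀ s ∈ Icc (0 : ℝ) l, ∀ t ∈ Icc (0 : ℝ) l, dist (p s) (p t) = |s - t|)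
    {s t : ℝ} (hs : 0 ≤ s) (hst : s ≤ t) (ht : t ≤ l) (hsu : dist u (p s) ≤ 2 * C)
    (htv : dist v (p t) ≤ 2 * C) : dist o u ≤ T + 2 * C := by
  have hC1 := hCV.1
  have h1 : Metric.infDist (p s) V ≤ 4 * (2 * C) := by
    refine hCV.infDist_le hVc ⟨o, hoV⟩
      (isGeodesicSegment_subsegment hp le_rfl (hs.trans hst) ht) (by linarith) ?_ ?_
      ⟨s, ⟨hs, hst⟩, rfl⟩
    · rw [hp0, Metric.infDist_zero_of_mem hoV]
      linarith
    · rw [dist_comm] at htv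
      exact (Metric.infDist_le_dist_of_mem hv).trans htv
  have h2 : dist o (p s) ≤ T := by
    refine hT o ⟨?_, ?_⟩ (p s) ⟨?_, ?_⟩
    · exact Metric.self_subset_cthickening U hoU
    · exact Metric.self_subset_cthickening V hoV
    · rw [dist_comm] at hsu
      exact Metric.mem_cthickening_of_dist_le _ u _ _ hu (by linarith)
    · exact mem_cthickening_of_infDist_le hVc ⟨o, hoV⟩ (by linarith)
  have h3 := dist_triangle_right o u (p s)
  linarith

/-- Of two contracting sets through `o` with bounded intersection, a point projects near `o` to at
least one. -/
theorem dist_proj_le_or [ProperSpace Y] (hY : IsGeodesicSpace Y) {C T : ℝ} {U V : Set Y}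
    {o x u v : Y} (hCU : IsContracting C U) (hCV : IsContracting C V)
    (hUc : IsClosed U) (hVc : IsClosed V) (hoU : o ∈ U) (hoV : o ∈ V)
    (hT : DiamLE (Metric.cthickening (8 * C) U ∩ Metric.cthickening (8 * C) V) T)
    (hu : u ∈ proj U {x}) (hv : v ∈ proj V {x}) :
    dist o u ≤ T + 2 * C ∨ dist o v ≤ T + 2 * C := by
  have hC1 := hCU.1
  by_contra! h
  -- This makes `T + 2 * C` exceed `C`, the separation needed for the geodesic to approach each
  -- projection.
  have hT0 : 0 ≤ T := by
    have := Metric.self_subset_cthickening (δ := 8 * C) U hoU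
    simpa using hT o ⟨this, Metric.self_subset_cthickening V hoV⟩ o
      ⟨this, Metric.self_subset_cthickening V hoV⟩
  have hself : ∀ W : Set Y, o ∈ W → o ∈ proj W {o} := fun W hW =>
    ⟨hW, o, rfl, by simp [Metric.infDist_zero_of_mem hW]⟩
  obtain ⟨S, hS⟩ := hY o x
  obtain ⟨z, hz, hzu⟩ := hCU.exists_dist_le hUc hS.symm hu (hself U hoU)
    (by rw [dist_comm]; linarith)
  obtain ⟨w, hw, hwv⟩ := hCV.exists_dist_le hVc hS.symm hv (hself V hoV)
    (by rw [dist_comm]; linarith)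
  obtain ⟨l, p, hl, hp0, -, rfl, hp⟩ := hS
  obtain ⟨s, hs, rfl⟩ := hz
  obtain ⟨t, ht, rfl⟩ := hw
  -- The set approached first along `[o, x]` has its projection near `o`, a contradiction.
  rcases le_total s t with hst | hst
  · exact h.1.not_ge (dist_le_of_bounded_intersection hCV hVc hoU hoV hT hu.1 hv.1 hp0 hp
      hs.1 hst ht.2 hzu hwv)
  · exact h.2.not_ge (dist_le_of_bounded_intersection hCU hUc hoV hoU
      (by rwa [inter_comm]) hv.1 hu.1 hp0 hp ht.1 hst hs.2 hwv hzu)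

theorem infDist_le_of_dist_le {S : Set Y} {a u z : Y} {r K : ℝ} (hz : z ∈ S)
    (hu : dist u z ≤ r) (ha : dist a u ≤ K) : Metric.infDist a S ≤ K + r :=
  (Metric.infDist_le_dist_of_mem hz).trans <| (dist_triangle a u z).trans (add_le_add ha hu)

theorem IsGeodesicSegment.isCompact {S : Set Y} {x y : Y} (h : IsGeodesicSegment S x y) :
    IsCompact S := by
  obtain ⟨l, p, -, -, -, rfl, hp⟩ := h
  exact isCompact_Icc.image_of_continuousOn (continuousOn_of_dist_eq hp)

theorem IsGeodesicSegment.left_mem {S : Set Y} {x y : Y} (h : IsGeodesicSegment S x y) :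
    x ∈ S := by
  obtain ⟨l, p, hl, rfl, -, rfl, -⟩ := h
  exact ⟨0, ⟨le_rfl, hl⟩, rfl⟩

theorem IsGeodesicSegment.dist_add_dist {S : Set Y} {x y z : Y} (h : IsGeodesicSegment S x y)
    (hz : z ∈ S) : dist x z + dist z y = dist x y := by
  obtain ⟨l, p, hl, rfl, rfl, rfl, hp⟩ := h
  obtain ⟨t, ht, rfl⟩ := hz
  rw [hp 0 ⟨le_rfl, hl⟩ t ht, hp t ht l ⟨hl, le_rfl⟩, hp 0 ⟨le_rfl, hl⟩ l ⟨hl, le_rfl⟩,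
    abs_of_nonpos (by linarith [ht.1]), abs_of_nonpos (by linarith [ht.2]),
    abs_of_nonpos (by linarith)]
  ring

/-- The difference splits at a point `w` of the geodesic in the ball; replacing `w` by `y` costs `r`
twice. -/
theorem dist_sub_le_of_mem_cone {x y z : Y} {r : ℝ} (h : z ∈ cone x (Metric.closedBall y r)) :
    dist x y - 2 * r ≤ dist x z - dist y z := by
  obtain ⟨S, hS, w, hw, hwy⟩ := h
  rw [Metric.mem_closedBall] at hwy
  have h1 := hS.dist_add_dist hw
  have h2 := dist_triangle x w y
  have h3 := dist_triangle_left y z w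
  linarith

end Metric

/-! ### Axes and the extension lemma -/

section Translate

variable {G Y : Type*} [Group G] [MulAction G Y]

theorem translate_one (A : Set Y) : translate (1 : G) A = A := by
  simp [translate]

theorem translate_mul (g k : G) (A : Set Y) :
    translate (g * k) A = translate g (translate k A) := by
  simp [translate, image_image, mul_smul]

theorem translate_cyclicOrbit {o : Y} {h k : G} (hk : k ∈ Subgroup.zpowers h) :
    translate k (cyclicOrbit o h) = cyclicOrbit o h := by
  obtain ⟨m, rfl⟩ := hk
  ext y
  constructor
  · rintro ⟨_, ⟨n, rfl⟩, rfl⟩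
    exact ⟨m + n, by simp [zpow_add, mul_smul]⟩
  · rintro ⟨n, rfl⟩
    exact ⟨h ^ (n - m) • o, ⟨n - m, rfl⟩, by simp [← mul_smul, ← zpow_add]⟩

end Translate

section Group

variable {G Y : Type*} [Group G] [MetricSpace Y] [MulAction G Y]

/-- By properness of the action, every ball meets the orbit in finitely many points. Closed axes
have nearest-point projections. -/
theorem isClosed_of_subset_orbit [ProperSpace Y] [ProperlyDiscontinuousSMul G Y] {o : Y}
    {A : Set Y} (hA : A ⊆ MulAction.orbit G o) : IsClosed A := by
  have hfin : ∀ y : Y, (A ∩ Metric.closedBall y 1).Finite := by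
    intro y
    have := ProperlyDiscontinuousSMul.finite_disjoint_inter_image (Γ := G)
      (isCompact_singleton (x := o)) (isCompact_closedBall y 1)
    refine (this.image fun g => g • o).subset ?_
    rintro _ ⟨ha, hb⟩
    obtain ⟨g, rfl⟩ := hA ha
    exact ⟨g, ⟨g • o, ⟨o, rfl, rfl⟩, hb⟩, rfl⟩
  refine isClosed_of_closure_subset fun y hy => ?_
  have hy' : y ∈ closure (A ∩ Metric.closedBall y 1) := by
    rw [mem_closure_iff_nhds] at hy ⊢
    intro t ht
    obtain ⟨z, hz, hzA⟩ := hy _ (inter_mem ht (Metric.closedBall_mem_nhds y one_pos))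
    exact ⟨z, hz.1, hzA, hz.2⟩
  rw [(hfin y).isClosed.closure_eq] at hy'
  exact hy'.1

theorem translate_cthickening [IsIsometricSMul G Y] (g : G) (r : ℝ) (A : Set Y) :
    translate g (Metric.cthickening r A) = Metric.cthickening r (translate g A) := by
  ext y
  simp only [translate, mem_image, Metric.mem_cthickening_iff]
  constructor
  · rintro ⟨z, hz, rfl⟩
    rwa [Metric.infEDist_image (isometry_smul Y g)]
  · intro hy
    refine ⟨g⁻¹ • y, ?_, smul_inv_smul g y⟩
    rwa [← Metric.infEDist_image (isometry_smul Y g), smul_inv_smul]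

/-- Powers of `h` preserve the cyclic orbit. This suffices for them to preserve the axis, without
showing that `E(h)` is a group. -/
theorem mul_mem_stabE [IsIsometricSMul G Y] {o : Y} {h k g : G} (hk : k ∈ Subgroup.zpowers h)
    (hg : g ∈ stabE o h) : k * g ∈ stabE o h := by
  obtain ⟨r, hr, h1, h2⟩ := hg
  refine ⟨r, hr, ?_, ?_⟩
  · rw [translate_mul]
    nth_rw 2 [← translate_cyclicOrbit (o := o) hk]
    rw [← translate_cthickening]
    exact image_mono h1
  · rw [translate_mul, ← translate_cthickening]
    nth_rw 1 [← translate_cyclicOrbit (o := o) hk]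
    exact image_mono h2

theorem one_mem_stabE (o : Y) (h : G) : (1 : G) ∈ stabE o h := by
  refine ⟨1, one_pos, ?_, ?_⟩ <;> rw [translate_one] <;>
    exact Metric.self_subset_cthickening _

theorem mem_axis (o : Y) (h : G) : o ∈ axis o h :=
  ⟨1, one_mem_stabE o h, one_smul G o⟩

theorem translate_axis [IsIsometricSMul G Y] {o : Y} {h k : G} (hk : k ∈ Subgroup.zpowers h) :
    translate k (axis o h) = axis o h := by
  ext y
  constructor
  · rintro ⟨_, ⟨g, hg, rfl⟩, rfl⟩
    exact ⟨k * g, mul_mem_stabE hk hg, mul_smul k g o⟩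
  · rintro ⟨g, hg, rfl⟩
    exact ⟨(k⁻¹ * g) • o, ⟨_, mul_mem_stabE (inv_mem hk) hg, rfl⟩, by simp [← mul_smul]⟩

theorem isClosed_axis [ProperSpace Y] [ProperlyDiscontinuousSMul G Y] (o : Y) (h : G) :
    IsClosed (axis o h) :=
  isClosed_of_subset_orbit (G := G) (o := o) (by rintro _ ⟨g, -, rfl⟩; exact ⟨g, rfl⟩)

theorem smul_mem_proj [IsIsometricSMul G Y] {U : Set Y} {k : G} (hk : translate k U = U)
    {x u : Y} (hu : u ∈ proj U {x}) : k • u ∈ proj U {k • x} := by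
  refine ⟨hk ▸ ⟨u, hu.1, rfl⟩, k • x, rfl, ?_⟩
  rw [dist_smul, dist_of_mem_proj hu]
  conv_rhs => rw [← hk]
  exact (Metric.infDist_image (isometry_smul Y k)).symm

/-- Three pairwise independent contracting elements: sufficiently long powers `f i` can be
inserted between any two points so that geodesics pass near `o` and `f i • o`. -/
theorem exists_extension [ProperSpace Y] (hY : IsGeodesicSpace Y) [IsIsometricSMul G Y]
    [ProperlyDiscontinuousSMul G Y] (o : Y) (h : Fin 3 → G)
    (hind : ∀ i j, i ≠ j → Independent o (h i) (h j)) :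
    ∃ L > (0 : ℝ), ∃ r₀ > (0 : ℝ), ∀ f : Fin 3 → G, (∀ i, f i ∈ Subgroup.zpowers (h i)) →
      (∀ i, L ≤ dist o (f i • o)) → ∀ x z : Y, ∃ i, ∀ S, IsGeodesicSegment S x (f i • z) →
        Metric.infDist o S ≤ r₀ ∧ Metric.infDist (f i • o) S ≤ r₀ := by
  have hcontr : ∃ C, ∀ i, IsContracting C (axis o (h i)) := by
    have : ∀ i, ∃ C, IsContracting C (axis o (h i)) := by
      intro i
      obtain ⟨j, hj⟩ := exists_ne i
      obtain ⟨C, hC⟩ := (hind i j hj.symm).1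
      exact ⟨C, hC _ ⟨1, Or.inl (translate_one _).symm⟩⟩
    choose C hC using this
    obtain ⟨M, hM⟩ := (finite_range C).bddAbove
    exact ⟨M, fun i => (hC i).mono (hM ⟨i, rfl⟩)⟩
  obtain ⟨C, hC⟩ := hcontr
  have hC1 : 1 ≤ C := (hC 0).1
  have hbdd : ∃ T : ℝ, 0 ≤ T ∧ ∀ i j, i ≠ j → DiamLE (Metric.cthickening (8 * C) (axis o (h i)) ∩
      Metric.cthickening (8 * C) (axis o (h j))) T := by
    have : ∀ q : Fin 3 × Fin 3, ∃ T : ℝ, q.1 ≠ q.2 →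
        DiamLE (Metric.cthickening (8 * C) (axis o (h q.1)) ∩
          Metric.cthickening (8 * C) (axis o (h q.2))) T := by
      rintro ⟨i, j⟩
      by_cases hij : i = j
      · exact ⟨0, fun h' => absurd hij h'⟩
      obtain ⟨-, ⟨τ, hτ⟩, hne⟩ := hind i j hij
      refine ⟨τ (8 * C), fun _ => hτ _ (by linarith) _ ⟨1, Or.inl (translate_one _).symm⟩ _
        ⟨1, Or.inr (translate_one _).symm⟩ ?_⟩
      simpa only [translate_one] using hne 1
    choose T hT using this
    obtain ⟨M, hM⟩ := (finite_range T).bddAbove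
    exact ⟨max M 0, le_max_right _ _, fun i j hij x hx y hy =>
      (hT (i, j) hij x hx y hy).trans ((hM ⟨(i, j), rfl⟩).trans (le_max_left _ _))⟩
  obtain ⟨T, hT0, hT⟩ := hbdd
  set K := T + 2 * C with hK
  -- `K` bounds the distance from `o` to a good projection. The length `L` exceeds the two errors
  -- `K` by more than `C`; near a projection, the geodesic is then within `2 * C` of it.
  refine ⟨2 * K + C + 1, by linarith, K + 2 * C, by linarith, fun f hf hL x z => ?_⟩
  have hproj : ∀ y i, ∃ u, u ∈ proj (axis o (h i)) {y} := fun y i =>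
    proj_nonempty (isClosed_axis o (h i)) ⟨o, mem_axis o (h i)⟩ y
  choose π hπ using hproj
  have hor : ∀ y i j, i ≠ j → dist o (π y i) ≤ K ∨ dist o (π y j) ≤ K := fun y i j hij =>
    dist_proj_le_or hY (hC i) (hC j) (isClosed_axis o _) (isClosed_axis o _) (mem_axis o _)
      (mem_axis o _) (hT i j hij) (hπ y i) (hπ y j)
  -- Each of `x` and `z` is bad for at most one axis, which leaves one of the three good for both.
  have hi : ∃ i, dist o (π x i) ≤ K ∧ dist o (π z i) ≤ K := by
    have a1 := hor x 0 1 (by decide)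
    have a2 := hor x 0 2 (by decide)
    have a3 := hor x 1 2 (by decide)
    have b1 := hor z 0 1 (by decide)
    have b2 := hor z 0 2 (by decide)
    have b3 := hor z 1 2 (by decide)
    by_contra! hcon
    have c0 := hcon 0
    have c1 := hcon 1
    have c2 := hcon 2
    grind
  obtain ⟨i, hx, hz⟩ := hi
  refine ⟨i, fun S hS => ?_⟩
  have hfz := smul_mem_proj (translate_axis (o := o) (hf i)) (hπ z i)
  have hfz' : dist (f i • o) (f i • π z i) ≤ K := by rwa [dist_smul]
  have hlong : C < dist (π x i) (f i • π z i) := by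
    -- `f i` preserves the axis, so it carries the projection of `z` to one of `f i • z`, close to
    -- `f i • o`.
    have h1 := dist_triangle4 o (π x i) (f i • π z i) (f i • o)
    rw [dist_comm (f i • π z i)] at h1
    linarith [hL i]
  obtain ⟨a, ha, hua⟩ := (hC i).exists_dist_le (isClosed_axis o _) hS (hπ x i) hfz hlong
  obtain ⟨b, hb, hvb⟩ := (hC i).exists_dist_le (isClosed_axis o _) hS.symm hfz (hπ x i)
    (by rwa [dist_comm])
  exact ⟨infDist_le_of_dist_le ha hua hx, infDist_le_of_dist_le hb hvb hfz'⟩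

end Group

/-! ### The boundary -/

theorem smul_mem_boundary {G Y X : Type*} [Group G] [MulAction G Y]
    [MulAction G X] {ι : Y → X} (hι : ∀ (g : G) (y : Y), ι (g • y) = g • ι y) (g : G)
    {ξ : X} (hξ : ξ ∈ boundary ι) : g • ξ ∈ boundary ι := by
  rintro ⟨y, hy⟩
  exact hξ ⟨g⁻¹ • y, by rw [hι, hy, inv_smul_smul]⟩

section PartialShadow

variable {G Y X : Type*} [Group G] [MetricSpace Y] [MulAction G Y] [TopologicalSpace X]

theorem partialShadow_mono (ι : Y → X) (o : Y) (F : Set G) (x y : Y) {r r' : ℝ} (hr : r ≤ r') :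
    partialShadow ι o F x y r ⊆ partialShadow ι o F x y r' := by
  refine inter_subset_inter_left _ (closure_mono (image_mono ?_))
  rintro z ⟨S, hS, k, hk, f, hf, hm⟩
  exact ⟨S, hS, k, hk, f, hf, hm.trans hr⟩

theorem partialShadow_subset_shadow (ι : Y → X) (o : Y) (F : Set G) (x y : Y) (r : ℝ) :
    partialShadow ι o F x y r ⊆ shadow ι x y r := by
  refine inter_subset_inter_left _ (closure_mono (image_mono ?_))
  rintro z ⟨S, hS, k, hk, f, hf, hm⟩
  -- Compactness makes the distance attained, so the closed ball needs no larger radius.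
  obtain ⟨w, hw, hd⟩ := hS.isCompact.exists_infDist_eq_dist ⟨x, hS.left_mem⟩ y
  refine ⟨S, hS, w, hw, ?_⟩
  rw [Metric.mem_closedBall, dist_comm, ← hd, ← hk]
  exact (le_max_left _ _).trans hm

end PartialShadow

section Boundary

variable {G Y X : Type*} [Group G] [MetricSpace Y] [MulAction G Y] [TopologicalSpace X]
  [MulAction G X]

theorem nonPinched_subset_boundary (ι : Y → X) (s : Setoid (boundary ι)) :
    nonPinched ι s ⊆ boundary ι := fun _ h => h.1

theorem exiting_of_image_smul [IsIsometricSMul G Y] {S : ℕ → Set Y} (g : G)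
    (h : Exiting fun n => (fun y => g • y) '' S n) : Exiting S := by
  intro o
  have := h (g • o)
  simpa only [Metric.infDist_image (isometry_smul Y g)] using this

/-- Sequences, classes and segments are all pulled back by `g⁻¹`. Invariance keeps translated points
in the set where conformality is available. -/
theorem smul_mem_nonPinched [IsIsometricSMul G Y] [ContinuousConstSMul G X] {ι : Y → X}
    {s : Setoid (boundary ι)} (hX : IsConvergenceCompactification G ι s) (g : G) {ξ : X}
    (hξ : ξ ∈ nonPinched ι s) : g • ξ ∈ nonPinched ι s := by
  obtain ⟨hb, hp⟩ := hξ
  have hgb := smul_mem_boundary hX.smul_map g hb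
  have hloc : ∀ η ∈ locus ι s ⟨g • ξ, hgb⟩, g⁻¹ • η ∈ locus ι s ⟨ξ, hb⟩ := by
    rintro η ⟨hη, hs⟩
    exact ⟨smul_mem_boundary hX.smul_map g⁻¹ hη,
      hX.partition_invariant g⁻¹ _ _ ⟨ξ, hb⟩ _ hs (by simp) rfl⟩
  have hconv : ∀ (x : ℕ → Y) (η : X), Tendsto (fun n => ι (x n)) atTop (𝓝 η) →
      Tendsto (fun n => ι (g⁻¹ • x n)) atTop (𝓝 (g⁻¹ • η)) := fun x η hx => by
    simpa only [hX.smul_map] using hx.const_smul g⁻¹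
  refine ⟨hgb, fun x y η hη ζ hζ hx hy S hS => exiting_of_image_smul g⁻¹ ?_⟩
  exact hp _ _ _ (hloc η hη) _ (hloc ζ hζ) (hconv x η hx) (hconv y ζ hy) _
    fun n => (hS n).image (isometry_smul Y g⁻¹)

/-- This turns the limsup condition into genuine points of any set accumulating at `ξ`, at the price
of an arbitrarily small `δ`. -/
theorem IsBusemannFamily.exists_abs_sub_le {ι : Y → X} {𝒞 : Set X} {B : X → Y → Y → ℝ} {ε : ℝ}
    (hB : IsBusemannFamily ι 𝒞 B ε) {ξ : X} (hξ : ξ ∈ 𝒞) {A : Set Y}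
    (hA : ξ ∈ closure (ι '' A)) (x y : Y) {δ : ℝ} (hδ : 0 < δ) :
    ∃ z ∈ A, |B ξ x y - (dist x z - dist y z)| < ε + δ := by
  -- A real `limsup` is informative only for a bounded function; the triangle inequality provides
  -- the bound.
  have hbd : IsBoundedUnder (· ≤ ·) (comap ι (𝓝 ξ))
      (fun z : Y => |B ξ x y - (dist x z - dist y z)|) := by
    refine ⟨|B ξ x y| + dist x y, eventually_map.2 (Eventually.of_forall fun z => ?_)⟩
    exact (abs_sub _ _).trans (by gcongr; exact abs_dist_sub_le x y z)
  have hev := eventually_lt_of_limsup_lt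
    ((hB ξ hξ x y).trans_lt (lt_add_of_pos_right ε hδ)) hbd
  obtain ⟨N, hN, hNs⟩ := mem_comap.1 hev
  obtain ⟨_, hzN, z, hz, rfl⟩ := mem_closure_iff_nhds.1 hA N hN
  exact ⟨z, hz, hNs hzN⟩

theorem IsBusemannFamily.neg_le_dist_add {ι : Y → X} {𝒞 : Set X} {B : X → Y → Y → ℝ} {ε : ℝ}
    (hB : IsBusemannFamily ι 𝒞 B ε) (hι : DenseRange ι) {ξ : X} (hξ : ξ ∈ 𝒞) (x y : Y) :
    -B ξ x y ≤ dist x y + ε := by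
  refine le_of_forall_pos_le_add fun δ hδ => ?_
  obtain ⟨z, -, hz⟩ := hB.exists_abs_sub_le hξ (A := univ)
    (by rw [image_univ]; exact hι ξ) x y hδ
  have h1 := (abs_lt.1 hz).1
  have h2 := dist_triangle_left y z x
  linarith

theorem IsBusemannFamily.dist_le_of_mem_shadow {ι : Y → X} {𝒞 : Set X} {B : X → Y → Y → ℝ}
    {ε r : ℝ} (hB : IsBusemannFamily ι 𝒞 B ε) {ξ : X} (hξ : ξ ∈ 𝒞) {x y : Y}
    (h : ξ ∈ shadow ι x y r) : dist x y - 2 * r - ε ≤ B ξ x y := by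
  refine le_of_forall_pos_le_add fun δ hδ => ?_
  obtain ⟨z, hzc, hz⟩ := hB.exists_abs_sub_le hξ h.1 x y hδ
  have h1 := (abs_lt.1 hz).1
  have h2 := dist_sub_le_of_mem_cone hzc
  linarith

theorem IsConvergenceCompactification.isClosed_boundary {ι : Y → X}
    {s : Setoid (boundary ι)}
    (hX : IsConvergenceCompactification G ι s) : IsClosed (boundary ι) :=
  hX.isOpenEmbedding.isOpen_range.isClosed_compl

/-- The non-pinched points are covered by the pullbacks of a partial shadow by three elements. -/
theorem nonPinched_subset_iUnion [IsIsometricSMul G Y] [ContinuousConstSMul G X]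
    {ι : Y → X} {s : Setoid (boundary ι)} {o : Y} (hY : IsGeodesicSpace Y)
    (hX : IsConvergenceCompactification G ι s) {f : Fin 3 → G} {r : ℝ}
    (hf : ∀ x z : Y, ∃ i, ∀ S, IsGeodesicSegment S x (f i • z) →
      Metric.infDist o S ≤ r ∧ Metric.infDist (f i • o) S ≤ r) (g : G) :
    nonPinched ι s ⊆ ⋃ i, (fun ξ => (g * f i) • ξ) ⁻¹'
      (partialShadow ι o (range f) o (g • o) r ∩ nonPinched ι s) := by
  intro ξ hξ
  -- Extension is applied to `g⁻¹ • o` and `z`; translating by `g` moves the barrier from `o` to `g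
  -- • o`.
  have hcone : ∀ z, ∃ i, (g * f i) • z ∈ partialCone o (range f) o (g • o) r := by
    intro z
    obtain ⟨i, hi⟩ := hf (g⁻¹ • o) z
    obtain ⟨S, hS⟩ := hY (g⁻¹ • o) (f i • z)
    have hgS := hS.image (isometry_smul Y g)
    rw [smul_inv_smul, ← mul_smul] at hgS
    refine ⟨i, _, hgS, g, rfl, f i, ⟨i, rfl⟩, ?_⟩
    rw [Metric.infDist_image (isometry_smul Y g), Metric.infDist_image (isometry_smul Y g)]
    exact max_le (hi S hS).1 (hi S hS).2
  have hun : range ι =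
      ⋃ i, ι '' {z | (g * f i) • z ∈ partialCone o (range f) o (g • o) r} := by
    rw [← image_iUnion, ← image_univ]
    congr 1
    exact (eq_univ_of_forall fun z => mem_iUnion.2 (hcone z)).symm
  have hcl := hX.denseRange ξ
  -- Finiteness of the cover puts `ξ` in the closure of a single piece.
  rw [hun, closure_iUnion_of_finite, mem_iUnion] at hcl
  obtain ⟨i, hi⟩ := hcl
  refine mem_iUnion.2 ⟨i, ⟨?_, smul_mem_boundary hX.smul_map _ hξ.1⟩,
    smul_mem_nonPinched hX _ hξ⟩
  refine map_mem_closure (continuous_const_smul (g * f i)) hi ?_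
  rintro _ ⟨z, hz, rfl⟩
  exact ⟨_, hz, hX.smul_map _ _⟩

end Boundary

/-! ### Comparison of measures -/

section Density

variable {X : Type*} [MeasurableSpace X] {ν μ : Measure X} [IsFiniteMeasure ν]
  [IsFiniteMeasure μ] {A K : Set X} {a b : X → ℝ}

theorem DerivBetween.le_mul (h : DerivBetween ν μ A a b) (hA : NullMeasurableSet A μ)
    (hK : MeasurableSet K) {b₀ : ℝ} (hb : ∀ ξ ∈ K ∩ A, b ξ ≤ b₀) :
    ν (K ∩ A) ≤ ENNReal.ofReal b₀ * μ (K ∩ A) := by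
  rw [← Measure.restrict_apply hK, ← Measure.restrict_apply hK,
    ← Measure.setLIntegral_rnDeriv h.1 K, ← setLIntegral_const]
  refine setLIntegral_mono_ae' hK ?_
  filter_upwards [h.2, ae_restrict_mem₀ hA] with ξ h1 h2 h3
  exact h1.2.trans (ENNReal.ofReal_le_ofReal (hb ξ ⟨h3, h2⟩))

theorem DerivBetween.mul_le (h : DerivBetween ν μ A a b) (hA : NullMeasurableSet A μ)
    (hK : MeasurableSet K) {a₀ : ℝ} (ha : ∀ ξ ∈ K ∩ A, a₀ ≤ a ξ) :
    ENNReal.ofReal a₀ * μ (K ∩ A) ≤ ν (K ∩ A) := by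
  rw [← Measure.restrict_apply hK, ← Measure.restrict_apply hK,
    ← Measure.setLIntegral_rnDeriv h.1 K, ← setLIntegral_const]
  refine setLIntegral_mono_ae' hK ?_
  filter_upwards [h.2, ae_restrict_mem₀ hA] with ξ h1 h2 h3
  exact (ENNReal.ofReal_le_ofReal (ha ξ ⟨h3, h2⟩)).trans h1.1

/-- A measurable hull of `E` for `μ` reduces this to the measurable case, so `E` may be arbitrary;
the non-pinched set is only null-measurable. -/
theorem DerivBetween.le_mul_of_subset (h : DerivBetween ν μ A a b) (hA : NullMeasurableSet A μ)
    {E : Set X} (hE : E ⊆ A) {b₀ : ℝ} (hb : ∀ ξ ∈ A, b ξ ≤ b₀) :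
    ν E ≤ ENNReal.ofReal b₀ * μ E := by
  calc ν E ≤ ν (toMeasurable μ E ∩ A) :=
        measure_mono (subset_inter (subset_toMeasurable μ E) hE)
    _ ≤ ENNReal.ofReal b₀ * μ (toMeasurable μ E ∩ A) :=
        h.le_mul hA (measurableSet_toMeasurable μ E) fun ξ hξ => hb ξ hξ.2
    _ ≤ ENNReal.ofReal b₀ * μ E := by
        rw [← measure_toMeasurable (μ := μ) E]
        gcongr
        exact inter_subset_left

end Density

/-! ### Upper and lower bounds for the measures of shadows -/

section Shadow

variable {G Y X : Type*} [Group G] [MetricSpace Y] [MulAction G Y]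
  [TopologicalSpace X] [MulAction G X] [MeasurableSpace X]
  {ι : Y → X} {s : Setoid (boundary ι)} {o : Y} {B : X → Y → Y → ℝ} {μ : Y → Measure X}
  {ω lam ε : ℝ}

variable [BorelSpace X] [ContinuousConstSMul G X]

/-- The pushforward of `μ o` by `g` has mass at most `1` on the boundary and dominates `1 / lam`
times `μ (g • o)` there. -/
theorem measure_boundary_le (hX : IsConvergenceCompactification G ι s) (hlam : 1 ≤ lam)
    (hμ : IsQuasiConformalDensity G ι (nonPinched ι s) B o ω lam μ) (g : G) :
    μ (g • o) (boundary ι) ≤ ENNReal.ofReal lam := by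
  have := hμ.finite
  have hbm : MeasurableSet (boundary ι) := hX.isClosed_boundary.measurableSet
  have h1 := (hμ.quasi_equivariant g o).mul_le hbm.nullMeasurableSet MeasurableSet.univ
    (a₀ := 1 / lam) fun _ _ => le_rfl
  rw [univ_inter] at h1
  have h2 : (μ o).map (fun ξ => g • ξ) (boundary ι) ≤ 1 := by
    rw [Measure.map_apply (measurable_const_smul g) hbm, ← hμ.normalized]
    exact measure_mono (subset_univ _)
  have h3 : ENNReal.ofReal lam * ENNReal.ofReal (1 / lam) = 1 := by
    rw [← ENNReal.ofReal_mul (by linarith), mul_one_div_cancel (by linarith), ENNReal.ofReal_one]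
  calc μ (g • o) (boundary ι)
      = ENNReal.ofReal lam * (ENNReal.ofReal (1 / lam) * μ (g • o) (boundary ι)) := by
        rw [← mul_assoc, h3, one_mul]
    _ ≤ ENNReal.ofReal lam * 1 := by gcongr; exact h1.trans h2
    _ = ENNReal.ofReal lam := mul_one _

/-- The upper bound in the shadow lemma. -/
theorem measure_shadow_le (hX : IsConvergenceCompactification G ι s) (hω : 0 < ω)
    (hlam : 1 ≤ lam) (hB : IsBusemannFamily ι (nonPinched ι s) B ε)
    (hμ : IsQuasiConformalDensity G ι (nonPinched ι s) B o ω lam μ)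
    (hm : ∀ x, NullMeasurableSet (nonPinched ι s) (μ x)) (r : ℝ) (g : G) :
    μ o (shadow ι o (g • o) r ∩ nonPinched ι s) ≤
      ENNReal.ofReal (lam ^ 2 * Real.exp (ω * (2 * r + ε)) *
        Real.exp (-ω * dist o (g • o))) := by
  have := hμ.finite
  have hK : MeasurableSet (shadow ι o (g • o) r) :=
    (isClosed_closure.inter hX.isClosed_boundary).measurableSet
  have h1 := hμ.quasi_conformal 1 g o
  rw [one_smul] at h1
  have h2 := h1.le_mul (hm _) hK
    (b₀ := lam * (Real.exp (ω * (2 * r + ε)) * Real.exp (-ω * dist o (g • o)))) (by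
      rintro ξ ⟨hξ, hξC⟩
      rw [← Real.exp_add]
      gcongr
      have := mul_le_mul_of_nonneg_left (hB.dist_le_of_mem_shadow hξC hξ) hω.le
      linarith)
  refine h2.trans ?_
  calc _ ≤ ENNReal.ofReal (lam * (Real.exp (ω * (2 * r + ε)) *
        Real.exp (-ω * dist o (g • o)))) * ENNReal.ofReal lam := by
        gcongr
        exact (measure_mono (inter_subset_right.trans (nonPinched_subset_boundary ι s))).trans
          (measure_boundary_le hX hlam hμ g)
    _ = _ := by
        rw [← ENNReal.ofReal_mul (by positivity)]
        congr 1
        ring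

/-- Pulling back a set of non-pinched points by `g` changes its `μ o`-measure by at most a factor
that is exponential in `d(o, g o)`. -/
theorem measure_preimage_smul_le (hX : IsConvergenceCompactification G ι s) (hω : 0 < ω)
    (hlam : 1 ≤ lam) (hB : IsBusemannFamily ι (nonPinched ι s) B ε)
    (hμ : IsQuasiConformalDensity G ι (nonPinched ι s) B o ω lam μ)
    (hm : ∀ x, NullMeasurableSet (nonPinched ι s) (μ x)) (g : G) {E : Set X}
    (hE : E ⊆ nonPinched ι s) :
    μ o ((fun ξ => g • ξ) ⁻¹' E) ≤
      ENNReal.ofReal (lam ^ 2 * Real.exp (ω * (dist o (g • o) + ε))) * μ o E := by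
  have := hμ.finite
  have hbm : MeasurableSet (boundary ι) := hX.isClosed_boundary.measurableSet
  -- One factor `lam` comes from equivariance here, the other from the change of base point in `h3`.
  have h1 : μ o ((fun ξ => g • ξ) ⁻¹' E) ≤ ENNReal.ofReal lam * μ (g • o) E :=
    (Measure.le_map_apply (measurable_const_smul g).aemeasurable E).trans
      ((hμ.quasi_equivariant g o).le_mul_of_subset hbm.nullMeasurableSet
        (hE.trans (nonPinched_subset_boundary ι s)) fun _ _ => le_rfl)
  have h2 := hμ.quasi_conformal g 1 o
  rw [one_smul] at h2
  have h3 : μ (g • o) E ≤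
      ENNReal.ofReal (lam * Real.exp (ω * (dist o (g • o) + ε))) * μ o E := by
    refine h2.le_mul_of_subset (hm _) hE fun ξ hξ => ?_
    have h4 := hB.neg_le_dist_add hX.denseRange hξ (g • o) o
    rw [dist_comm] at h4
    rw [neg_mul_comm]
    gcongr
  refine h1.trans ?_
  calc _ ≤ ENNReal.ofReal lam *
        (ENNReal.ofReal (lam * Real.exp (ω * (dist o (g • o) + ε))) * μ o E) := by gcongr
    _ = _ := by
        rw [← mul_assoc, ← ENNReal.ofReal_mul (by linarith)]
        congr 2
        ring

/-- The lower bound in the shadow lemma. -/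
theorem le_measure_partialShadow [IsIsometricSMul G Y] (hY : IsGeodesicSpace Y)
    (hX : IsConvergenceCompactification G ι s) {f : Fin 3 → G} {r m : ℝ}
    (hf : ∀ x z : Y, ∃ i, ∀ S, IsGeodesicSegment S x (f i • z) →
      Metric.infDist o S ≤ r ∧ Metric.infDist (f i • o) S ≤ r) (hω : 0 < ω)
    (hlam : 1 ≤ lam) (hB : IsBusemannFamily ι (nonPinched ι s) B ε)
    (hμ : IsQuasiConformalDensity G ι (nonPinched ι s) B o ω lam μ)
    (hm : ∀ x, NullMeasurableSet (nonPinched ι s) (μ x))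
    (hpos : ENNReal.ofReal m ≤ μ o (nonPinched ι s)) (g : G) :
    ENNReal.ofReal (m / (∑ i, lam ^ 2 * Real.exp (ω * (dist o (f i • o) + ε))) *
        Real.exp (-ω * dist o (g • o))) ≤
      μ o (partialShadow ι o (range f) o (g • o) r ∩ nonPinched ι s) := by
  set E := partialShadow ι o (range f) o (g • o) r ∩ nonPinched ι s
  set Z := ∑ i, lam ^ 2 * Real.exp (ω * (dist o (f i • o) + ε)) with hZ
  have hZpos : 0 < Z := Finset.sum_pos (fun i _ => by positivity) Finset.univ_nonempty
  have h1 : ENNReal.ofReal m ≤ ENNReal.ofReal (Z * Real.exp (ω * dist o (g • o))) * μ o E := by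
    calc ENNReal.ofReal m ≤ μ o (⋃ i, (fun ξ => (g * f i) • ξ) ⁻¹' E) :=
          hpos.trans (measure_mono (nonPinched_subset_iUnion hY hX hf g))
      _ ≤ ∑ i, μ o ((fun ξ => (g * f i) • ξ) ⁻¹' E) := measure_iUnion_fintype_le _ _
      _ ≤ ∑ i, ENNReal.ofReal (lam ^ 2 * Real.exp (ω * (dist o (f i • o) + ε)) *
            Real.exp (ω * dist o (g • o))) * μ o E := by
          refine Finset.sum_le_sum fun i _ =>
            (measure_preimage_smul_le hX hω hlam hB hμ hm (g * f i) inter_subset_right).trans ?_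
          -- The triangle inequality separates the cost of `f i`, which goes into `Z`, from that of
          -- `g`.
          have h2 := dist_triangle o (g • o) ((g * f i) • o)
          rw [mul_smul, dist_smul] at h2
          rw [mul_assoc (lam ^ 2), ← Real.exp_add, ← mul_add, mul_smul]
          refine mul_le_mul_left (ENNReal.ofReal_le_ofReal (mul_le_mul_of_nonneg_left
            (Real.exp_le_exp.2 (mul_le_mul_of_nonneg_left ?_ hω.le)) (sq_nonneg lam))) _
          linarith
      _ = _ := by
          rw [← Finset.sum_mul, ← ENNReal.ofReal_sum_of_nonneg fun i _ => by positivity,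
            ← Finset.sum_mul]
  have hW : 0 < Z * Real.exp (ω * dist o (g • o)) := by positivity
  have h2 : m / Z * Real.exp (-ω * dist o (g • o)) =
      m / (Z * Real.exp (ω * dist o (g • o))) := by
    rw [neg_mul, Real.exp_neg]
    field_simp
  rw [h2, ENNReal.ofReal_div_of_pos hW]
  exact ENNReal.div_le_of_le_mul' h1

end Shadow

end ShadowLemma

theorem mainTheorem2 {G Y X : Type*} [Group G]
    [MetricSpace Y] [ProperSpace Y] (hY : ShadowLemma.IsGeodesicSpace Y)
    [MulAction G Y] [IsIsometricSMul G Y] [ProperlyDiscontinuousSMul G Y]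
    [TopologicalSpace X] [CompactSpace X] [TopologicalSpace.MetrizableSpace X]
    [MulAction G X] [ContinuousConstSMul G X] [MeasurableSpace X] [BorelSpace X]
    (ι : Y → X) (s : Setoid (ShadowLemma.boundary ι))
    (hX : ShadowLemma.IsConvergenceCompactification G ι s)
    (o : Y) (h : Fin 3 → G)
    (hh : ∀ i, ShadowLemma.IsContractingElement o (h i))
    (hind : ∀ i j, i ≠ j → ShadowLemma.Independent o (h i) (h j)) :
    ∃ L > (0 : ℝ), ∃ r₀ > (0 : ℝ), ∃ D : ℝ → ℝ → ℝ → ℝ → ℝ,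
      ∀ f : Fin 3 → G, (∀ i, f i ∈ Subgroup.zpowers (h i)) → (∀ i, L ≤ dist o (f i • o)) →
      ∀ ω lam ε m : ℝ, 0 < ω → 1 ≤ lam → 0 ≤ ε → 0 < m →
      ∃ c > (0 : ℝ),
        ∀ (B : X → Y → Y → ℝ) (μ : Y → Measure X),
          ShadowLemma.IsBusemannFamily ι (ShadowLemma.nonPinched ι s) B ε →
          ShadowLemma.IsQuasiConformalDensity G ι (ShadowLemma.nonPinched ι s) B o ω lam μ →
          (∀ x, NullMeasurableSet (ShadowLemma.nonPinched ι s) (μ x)) →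
          ENNReal.ofReal m ≤ μ o (ShadowLemma.nonPinched ι s) →
          ∀ r, r₀ ≤ r → ∀ g : G,
            ENNReal.ofReal (c * Real.exp (-ω * dist o (g • o))) ≤
              μ o (ShadowLemma.partialShadow ι o (range f) o (g • o) r ∩
                ShadowLemma.nonPinched ι s) ∧
            μ o (ShadowLemma.partialShadow ι o (range f) o (g • o) r ∩
                ShadowLemma.nonPinched ι s) ≤
              μ o (ShadowLemma.shadow ι o (g • o) r ∩ ShadowLemma.nonPinched ι s) ∧
            μ o (ShadowLemma.shadow ι o (g • o) r ∩ ShadowLemma.nonPinched ι s) ≤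
              ENNReal.ofReal (D ω lam ε r * Real.exp (-ω * dist o (g • o))) := by
  obtain ⟨L, hL, r₀, hr₀, hext⟩ := ShadowLemma.exists_extension hY o h hind
  refine ⟨L, hL, r₀, hr₀, fun ω lam ε r => lam ^ 2 * Real.exp (ω * (2 * r + ε)),
    fun f hf hfL ω lam ε m hω hlam _ hm => ?_⟩
  refine ⟨m / ∑ i, lam ^ 2 * Real.exp (ω * (dist o (f i • o) + ε)),
    div_pos hm (Finset.sum_pos (fun i _ => by positivity) Finset.univ_nonempty),
    fun B μ hB hμ hmeas hpos r hr g => ⟨?_, ?_, ?_⟩⟩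
  -- The bound is taken at `r₀`, and partial shadows grow with the radius, so `c` does not depend on
  -- `r`.
  · exact (ShadowLemma.le_measure_partialShadow hY hX (hext f hf hfL) hω hlam hB hμ hmeas hpos
      g).trans (measure_mono (inter_subset_inter_left _
        (ShadowLemma.partialShadow_mono ι o _ o _ hr)))
  · exact measure_mono (inter_subset_inter_left _
      (ShadowLemma.partialShadow_subset_shadow ι o _ o _ r))
  · exact ShadowLemma.measure_shadow_le hX hω hlam hB hμ hmeas r g
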